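/- Let $\mathcal U$ be a universe of $m$ IDs. An input is a finite sequence of updates $S=(i_1,d_1),\dots,(i_t,d_t)\in(\mathcal U\times\mathbb Z)^t$, either with all $d_k\ge 0$ (cash register model) or with arbitrary $d_k$ (turnstile model). Its state vector is $a[i]=\sum_{k:\,i_k=i}d_k$, and its distinct count is $D(S)=|\{i\in\mathcal U: a[i]\ne 0\}|$. Two inputs $S,S'$ are neighbors if there are IDs $i\neq j$, a set $K$ of indices of updates of $i$ in $S$ and a set $K'$ of indices of updates of $j$ in $S'$ such that $\sum_{k\in K}d_k=\sum_{k\in K'}d'_k$ and, for every ID, the updates of $S$ outside $K$ and those of $S'$ outside $K'$ have the same total. An online algorithm on $\mathcal U$ has an arbitrary (measurable) set of internal states, a random initial state, a randomized transition of the state for each arriving update, and a randomized real output computed from the current state. It is $\varepsilon$-pan-private (against a single intrusion) if for all neighboring inputs $S,S'$ of the model and all measurable sets $I'$ of states and $\sigma'$ of outputs, $\Pr[(\text{state},\text{output})(S)\in I'\times\sigma']\le e^{\varepsilon}\,\Pr[(\text{state},\text{output})(S')\in I'\times\sigma']$. Let $\rho^*=\Pr[|Z|>\sqrt{2\ln 2}]\approx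 0.239$, where $Z$ is a standard Gaussian. **Statement.** Fix either of the two input models. Let $\eta\ge 0$ and $\delta<\rho^*/(6(1+\eta))$ be constants, let $\alpha(m)=o(\sqrt m)$, and let $\varepsilon$ be any constant. Then for all sufficiently large $m$, no online algorithm on a universe of $m$ IDs which on every input $S$ of the model outputs a value in $[D(S)-\alpha(m),\,D(S)+\alpha(m)]$ with probability at least $1-\delta$ is $\varepsilon$-pan-private for that model. -/

import Mathlib

open MeasureTheory ProbabilityTheory Filter Asymptotics

universe u

namespace PanPrivacy

/-- An update `(i, d)`: the count of the ID `i` changes by the integer `d`. -/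
abbrev Update (U : Type*) := U × ℤ

/-- The two input models: in the cash register model all updates satisfy `d ≥ 0`,
in the turnstile model updates are arbitrary. -/
inductive StreamModel where
  | cashRegister
  | turnstile

/-- `M.Admissible S`: the finite sequence of updates `S` is an input of the model `M`. -/
def StreamModel.Admissible {U : Type*} : StreamModel → List (Update U) → Prop
  | .cashRegister, S => ∀ x ∈ S, 0 ≤ x.2
  | .turnstile, _ => True

/-- The `i`-th coordinate of the state vector of `S`: the sum of all `d_k` with `i_k = i`. -/
def stateVector {U : Type*} [DecidableEq U] (S : List (Update U)) (i : U) : ℤ :=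
  ∑ k : Fin S.length with (S.get k).1 = i, (S.get k).2

/-- The distinct count `D(S)`: the number of IDs whose state vector entry is nonzero. -/
def distinctCount {U : Type*} [Fintype U] [DecidableEq U] (S : List (Update U)) : ℕ :=
  Finset.card {i : U | stateVector S i ≠ 0}

/-- User-level neighbours: some of the updates of one ID `i` in `S` (those indexed by `K`) are
replaced in `S'` by updates of another ID `j` (those indexed by `K'`) with the same total, and the
remaining updates of `S` and of `S'` have the same total for every ID. The order of the updates,
their number, and the way in which totals are broken up may differ. -/
def Neighbors {U : Type*} [DecidableEq U] (S S' : List (Update U)) : Prop :=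
  ∃ i j : U, i ≠ j ∧ ∃ (K : Finset (Fin S.length)) (K' : Finset (Fin S'.length)),
    (∀ k ∈ K, (S.get k).1 = i) ∧
    (∀ k ∈ K', (S'.get k).1 = j) ∧
    ∑ k ∈ K, (S.get k).2 = ∑ k ∈ K', (S'.get k).2 ∧
    ∀ l : U, ∑ k ∈ Kᶜ with (S.get k).1 = l, (S.get k).2 =
      ∑ k ∈ K'ᶜ with (S'.get k).1 = l, (S'.get k).2

/-- A randomized online algorithm over the ID universe `U`, with an arbitrary (possibly infinite)
set of internal states: a random initial state, a randomized transition of the state for each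
arriving update, and a randomized real-valued output computed from the current state. -/
structure OnlineAlgorithm (U : Type*) where
  State : Type u
  [measurableSpaceState : MeasurableSpace State]
  init : Measure State
  [isProbabilityMeasure_init : IsProbabilityMeasure init]
  step : Update U → Kernel State State
  [isMarkovKernel_step : ∀ x, IsMarkovKernel (step x)]
  output : Kernel State ℝ
  [isMarkovKernel_output : IsMarkovKernel output]

attribute [instance] OnlineAlgorithm.measurableSpaceState
  OnlineAlgorithm.isProbabilityMeasure_init OnlineAlgorithm.isMarkovKernel_step
  OnlineAlgorithm.isMarkovKernel_output

namespace OnlineAlgorithm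

variable {U : Type*}

/-- The law of the internal state after the updates `S` have been processed in order. -/
noncomputable def stateLaw (A : OnlineAlgorithm.{u} U) (S : List (Update U)) : Measure A.State :=
  S.foldl (fun μ x => μ.bind (A.step x)) A.init

/-- The joint law of the pair (internal state, output) on input `S`. -/
noncomputable def law (A : OnlineAlgorithm.{u} U) (S : List (Update U)) : Measure (A.State × ℝ) :=
  (A.stateLaw S) ⊗ₘ A.output

/-- On every input `S` of the model, the output is `D(S) ± α` with probability at least
`1 - δ`. -/
def EstimatesDistinctCount [Fintype U] [DecidableEq U] (A : OnlineAlgorithm.{u} U)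
    (M : StreamModel) (α δ : ℝ) : Prop :=
  ∀ S : List (Update U), M.Admissible S →
    1 - δ ≤ (A.law S).real {p | |p.2 - (distinctCount S : ℝ)| ≤ α}

/-- User-level `ε`-pan-privacy against a single intrusion: the joint law of the internal state and
the output changes by a factor of at most `exp ε` between neighbouring inputs of the model. -/
def PanPrivate [DecidableEq U] (A : OnlineAlgorithm.{u} U) (M : StreamModel) (ε : ℝ) : Prop :=
  ∀ S S' : List (Update U), M.Admissible S → M.Admissible S' → Neighbors S S' →
    ∀ (I' : Set A.State) (σ' : Set ℝ), MeasurableSet I' → MeasurableSet σ' →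
      A.law S (I' ×ˢ σ') ≤ ENNReal.ofReal (Real.exp ε) * A.law S' (I' ×ˢ σ')

end OnlineAlgorithm

/-- The critical error rate `ρ* ≈ 0.239` of linear programming decoding: `ρ* = P(|Z| > c)` for a
standard Gaussian `Z`, where `c` is the point with `E[|Z|; |Z| > c] = E[|Z|; |Z| ≤ c]`. Since
`E[|Z|; |Z| > c] = exp (-c ^ 2 / 2) * E|Z|`, this point is `c = √(2 log 2)`. -/
noncomputable def rhoStar : ℝ :=
  (gaussianReal 0 1).real {z | √(2 * Real.log 2) < |z|}

end PanPrivacy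

namespace PanPrivacy

/-! The proof is a reconstruction attack. A secret `z` of `n` bits is written into the stream by
inserting, at each position, one of two IDs; appending the encoding of a query `q` makes the
distinct count `n + hammingDist z q`. The state reached after `z` thus answers every query, each
with error at most `a` with high probability. If two vectors both fit most answers of one state, a
fourth-moment bound for Rademacher sums keeps them within distance `O(a ^ 2)`
(`hammingDist_mul_le`), so any vector consistent with the state recovers `z` up to `k = O(a ^ 2)`
bits. Flipping a bit of `z` gives a neighboring input, so privacy bounds the expected number of
correct bits, at least a constant times `n - k`, by `exp ε` times the expected number of wrong bits,
at most `k` (`reconstruction_bound`). With `a = o(√m)` and `n` about `m / 2` this fails. -/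

/-! ### Rademacher sums and Hamming distances. -/

/-- The sign `±1` of a bit. -/
def bitSign (b : Bool) : ℝ := if b then 1 else -1

/-- Summation over the first bit of a bit vector. -/
lemma sum_fin_succ_bool {n : ℕ} (f : (Fin (n + 1) → Bool) → ℝ) :
    ∑ q, f q = ∑ q : Fin n → Bool, (f (Fin.cons true q) + f (Fin.cons false q)) := by
  rw [← (Fin.consEquiv fun _ : Fin (n + 1) => Bool).sum_comp, Fintype.sum_prod_type_right]
  simp [Fin.consEquiv]

/-- The second moment of a Rademacher sum. -/
lemma sum_rademacher_sq {n : ℕ} (w : Fin n → ℝ) :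
    ∑ q : Fin n → Bool, (∑ i, w i * bitSign (q i)) ^ 2 = 2 ^ n * ∑ i, w i ^ 2 := by
  induction n with
  | zero => simp
  | succ n ih =>
    have h := ih fun i => w i.succ
    rw [sum_fin_succ_bool]
    simp only [Fin.sum_univ_succ, Fin.cons_zero, Fin.cons_succ, bitSign, if_true,
      Bool.false_eq_true, if_false] at h ⊢
    rw [Finset.sum_congr rfl fun q _ => show _ = 2 * w 0 ^ 2 +
      2 * (∑ i : Fin n, w i.succ * (if q i = true then 1 else -1)) ^ 2 by ring,
      Finset.sum_add_distrib, ← Finset.mul_sum Finset.univ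
        (fun q : Fin n → Bool => (∑ i : Fin n, w i.succ * (if q i = true then 1 else -1)) ^ 2), h]
    simp
    ring

/-- The fourth moment of a Rademacher sum is at most three times the square of the second. -/
lemma sum_rademacher_pow_four_le {n : ℕ} (w : Fin n → ℝ) :
    ∑ q : Fin n → Bool, (∑ i, w i * bitSign (q i)) ^ 4 ≤ 3 * 2 ^ n * (∑ i, w i ^ 2) ^ 2 := by
  induction n with
  | zero => simp
  | succ n ih =>
    have h := ih fun i => w i.succ
    have h2 := sum_rademacher_sq fun i => w i.succ
    rw [sum_fin_succ_bool]
    simp only [Fin.sum_univ_succ, Fin.cons_zero, Fin.cons_succ, bitSign, if_true,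
      Bool.false_eq_true, if_false] at h h2 ⊢
    -- The odd powers of `w 0` cancel between the two signs.
    rw [Finset.sum_congr rfl fun q _ => show _ = 2 * w 0 ^ 4 +
      12 * w 0 ^ 2 * (∑ i : Fin n, w i.succ * (if q i = true then 1 else -1)) ^ 2 +
      2 * (∑ i : Fin n, w i.succ * (if q i = true then 1 else -1)) ^ 4 by ring,
      Finset.sum_add_distrib, Finset.sum_add_distrib,
      ← Finset.mul_sum Finset.univ
        (fun q : Fin n → Bool => (∑ i : Fin n, w i.succ * (if q i = true then 1 else -1)) ^ 2),
      ← Finset.mul_sum Finset.univ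
        (fun q : Fin n → Bool => (∑ i : Fin n, w i.succ * (if q i = true then 1 else -1)) ^ 4), h2]
    simp only [Finset.sum_const, Finset.card_univ, Fintype.card_pi, Fintype.card_bool,
      Finset.prod_const, Fintype.card_fin, nsmul_eq_mul, Nat.cast_pow, Nat.cast_ofNat]
    have : (0 : ℝ) ≤ 2 ^ n * w 0 ^ 4 := by positivity
    rw [pow_succ (2 : ℝ) n]
    nlinarith

lemma hammingDist_eq_sum {n : ℕ} (z q : Fin n → Bool) :
    (hammingDist z q : ℝ) = ∑ i, (1 - bitSign (z i) * bitSign (q i)) / 2 := by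
  rw [hammingDist, Finset.card_filter, Nat.cast_sum]
  refine Finset.sum_congr rfl fun i _ => ?_
  cases z i <;> cases q i <;> norm_num [bitSign]

/-- For random `q` this is a Rademacher sum whose coefficients are `±1` where `z` and `y` differ and
`0` elsewhere. -/
lemma hammingDist_sub_eq {n : ℕ} (z y q : Fin n → Bool) :
    (hammingDist z q : ℝ) - hammingDist y q =
      ∑ i, (bitSign (y i) - bitSign (z i)) / 2 * bitSign (q i) := by
  rw [hammingDist_eq_sum, hammingDist_eq_sum, ← Finset.sum_sub_distrib]
  exact Finset.sum_congr rfl fun i _ => by ring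

lemma sum_sq_bitSign_sub {n : ℕ} (z y : Fin n → Bool) :
    ∑ i, ((bitSign (y i) - bitSign (z i)) / 2) ^ 2 = (hammingDist z y : ℝ) := by
  rw [hammingDist_eq_sum]
  refine Finset.sum_congr rfl fun i _ => ?_
  cases z i <;> cases y i <;> norm_num [bitSign]

/-- If the distances of two bit vectors to all but a `β`-fraction of the bit vectors differ by at
most `2 * a`, then the two are close to each other. -/
lemma hammingDist_mul_le {n : ℕ} (z y : Fin n → Bool) {a β : ℝ}
    (h : (Finset.card {q : Fin n → Bool |
      2 * a < |(hammingDist z q : ℝ) - hammingDist y q|} : ℝ) ≤ β * 2 ^ n) :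
    (hammingDist z y : ℝ) * (1 - 3 * β) ≤ 8 * a ^ 2 := by
  have h2 := sum_rademacher_sq fun i => (bitSign (y i) - bitSign (z i)) / 2
  have h4 := sum_rademacher_pow_four_le fun i => (bitSign (y i) - bitSign (z i)) / 2
  simp only [← hammingDist_sub_eq, sum_sq_bitSign_sub] at h2 h4
  set k : ℝ := (hammingDist z y : ℝ) with hk
  have hk0 : 0 ≤ k := Nat.cast_nonneg _
  rcases hk0.eq_or_lt with h0 | hpos
  · rw [← h0, zero_mul]; positivity
  -- For a large difference `r` this follows from `(r ^ 2 - 3 * k) ^ 2 ≥ 0`, otherwise from `r ^ 2 ≤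
  -- 4 * a ^ 2`. The factor 3 matches the fourth-moment constant.
  have key : ∀ q : Fin n → Bool, 6 * k * ((hammingDist z q : ℝ) - hammingDist y q) ^ 2 ≤
      24 * k * a ^ 2 + ((hammingDist z q : ℝ) - hammingDist y q) ^ 4 +
      9 * k ^ 2 * (if 2 * a < |(hammingDist z q : ℝ) - hammingDist y q| then 1 else 0) := by
    intro q
    generalize (hammingDist z q : ℝ) - hammingDist y q = r
    split_ifs with hr
    · nlinarith [sq_nonneg (r ^ 2 - 3 * k), mul_nonneg hk0 (sq_nonneg a)]
    · have : r ^ 2 ≤ (2 * a) ^ 2 := sq_le_sq' (by linarith [neg_abs_le r]) (by linarith [le_abs_self r])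
      nlinarith [sq_nonneg (r ^ 2), mul_le_mul_of_nonneg_left this hk0]
  have hs := Finset.sum_le_sum fun q (_ : q ∈ Finset.univ) => key q
  simp only [Finset.sum_add_distrib, ← Finset.mul_sum, Finset.sum_boole, h2,
    Finset.sum_const, Finset.card_univ, Fintype.card_pi, Fintype.card_bool,
      Finset.prod_const, Fintype.card_fin, nsmul_eq_mul, Nat.cast_pow, Nat.cast_ofNat] at hs
  have h' := mul_le_mul_of_nonneg_left h (by positivity : 0 ≤ 9 * k ^ 2)
  have hN : (0 : ℝ) < 3 * k * 2 ^ n := by positivity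
  refine le_of_mul_le_mul_left ?_ hN
  linarith

/-- The bit vector `z` with the bit `i` flipped. -/
def flipBit {n : ℕ} (z : Fin n → Bool) (i : Fin n) : Fin n → Bool :=
  Function.update z i (!z i)

lemma flipBit_self {n : ℕ} (z : Fin n → Bool) (i : Fin n) : flipBit z i i = !z i := by
  simp [flipBit]

lemma flipBit_flipBit {n : ℕ} (z : Fin n → Bool) (i : Fin n) : flipBit (flipBit z i) i = z := by
  simp [flipBit]

lemma abs_hammingDist_flipBit_sub_le {n : ℕ} (z q : Fin n → Bool) (i : Fin n) :
    |(hammingDist z q : ℝ) - hammingDist (flipBit z i) q| ≤ 1 := by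
  rw [hammingDist_sub_eq, Finset.sum_eq_single i]
  · rw [flipBit_self]
    cases z i <;> cases q i <;> norm_num [bitSign]
  · intro j _ hj
    simp [flipBit, hj]
  · simp

/-! ### The reconstruction attack. -/

section Reconstruction

variable {Ω : Type*} [MeasurableSpace Ω] {n : ℕ}

/-- The expected number of queries `q` to which the state `s` gives an answer that differs by more
than `a` from the answer `n + hammingDist z q` that is correct for `z`. -/
noncomputable def errorMass (F : (Fin n → Bool) → Kernel Ω ℝ) (a : ℝ) (z : Fin n → Bool)
    (s : Ω) : ℝ :=
  ∑ q, (F q s).real {r | a < |r - (n + hammingDist z q : ℝ)|}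

lemma measurableSet_lt_abs_sub (a c : ℝ) : MeasurableSet {r : ℝ | a < |r - c|} :=
  measurableSet_lt measurable_const (by fun_prop)

lemma measurable_errorMass (F : (Fin n → Bool) → Kernel Ω ℝ) (a : ℝ) (z : Fin n → Bool) :
    Measurable (errorMass F a z) :=
  Finset.measurable_sum _ fun q _ =>
    ((F q).measurable_coe (measurableSet_lt_abs_sub _ _)).ennreal_toReal

lemma errorMass_nonneg (F : (Fin n → Bool) → Kernel Ω ℝ) (a : ℝ) (z : Fin n → Bool) (s : Ω) :
    0 ≤ errorMass F a z s :=
  Finset.sum_nonneg fun _ _ => measureReal_nonneg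

/-- A flip moves each correct answer by at most 1, which the larger tolerance absorbs. -/
lemma errorMass_flipBit_le (F : (Fin n → Bool) → Kernel Ω ℝ) [∀ q, IsMarkovKernel (F q)] (a : ℝ)
    (z : Fin n → Bool) (i : Fin n) (s : Ω) :
    errorMass F (a + 1) (flipBit z i) s ≤ errorMass F a z s := by
  refine Finset.sum_le_sum fun q _ => measureReal_mono fun r hr => ?_
  have h := abs_hammingDist_flipBit_sub_le z q i
  simp only [Set.mem_ofPred_eq] at hr ⊢
  have := abs_sub_le r (n + hammingDist z q : ℝ) (n + hammingDist (flipBit z i) q)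
  rw [add_sub_add_left_eq_sub] at this
  linarith

/-- Two bit vectors that are both consistent with most answers of a state are close. -/
lemma hammingDist_mul_le_of_errorMass_le (F : (Fin n → Bool) → Kernel Ω ℝ)
    [∀ q, IsMarkovKernel (F q)] {a θ : ℝ} {z y : Fin n → Bool} {s : Ω}
    (hz : errorMass F a z s ≤ θ * 2 ^ n) (hy : errorMass F a y s ≤ θ * 2 ^ n) :
    (hammingDist z y : ℝ) * (1 - 6 * θ) ≤ 8 * a ^ 2 := by
  -- If the correct answers for `z` and `y` are more than `2 * a` apart, every answer is wrong for
  -- one of them, whence `2 * θ` and the threshold `θ < 1 / 6`.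
  have := hammingDist_mul_le z y (a := a) (β := 2 * θ) ?_
  · linarith
  calc _ = ∑ q : Fin n → Bool,
        (if 2 * a < |(hammingDist z q : ℝ) - hammingDist y q| then (1 : ℝ) else 0) := by
        rw [Finset.sum_boole]
    _ ≤ ∑ q, ((F q s).real {r | a < |r - (n + hammingDist z q : ℝ)|} +
        (F q s).real {r | a < |r - (n + hammingDist y q : ℝ)|}) := by
        refine Finset.sum_le_sum fun q _ => ?_
        split_ifs with hq
        · refine le_trans ?_ (measureReal_union_le _ _)
          rw [← probReal_univ (μ := F q s)]
          refine measureReal_mono fun r _ => ?_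
          by_contra hr
          simp only [Set.mem_union, Set.mem_ofPred_eq, not_or, not_lt] at hr
          have := abs_sub_le (n + hammingDist z q : ℝ) r (n + hammingDist y q)
          rw [add_sub_add_left_eq_sub, abs_sub_comm _ r] at this
          linarith [hr.1, hr.2]
        · positivity
    _ ≤ _ := by
        rw [Finset.sum_add_distrib]
        unfold errorMass at hz hy
        linarith

/-- The states that are consistent with `z`: the expected fraction of their answers with an error
of more than `a` is at most `θ`. -/
def consistentStates (F : (Fin n → Bool) → Kernel Ω ℝ) (a θ : ℝ) (z : Fin n → Bool) : Set Ω :=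
  {s | errorMass F a z s ≤ θ * 2 ^ n}

lemma measurableSet_consistentStates (F : (Fin n → Bool) → Kernel Ω ℝ) (a θ : ℝ)
    (z : Fin n → Bool) : MeasurableSet (consistentStates F a θ z) :=
  measurableSet_le (measurable_errorMass F a z) measurable_const

/-- A measurable choice of a bit vector consistent with the state. -/
lemma exists_decoder (F : (Fin n → Bool) → Kernel Ω ℝ) (a θ : ℝ) :
    ∃ D : Ω → Fin n → Bool, Measurable D ∧
      ∀ z s, s ∈ consistentStates F a θ z → s ∈ consistentStates F a θ (D s) := by
  classical
  -- The decoder factors through the finite table of consistent vectors, so the choice `g` is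
  -- automatically measurable.
  let C : Ω → (Fin n → Bool) → Bool := fun s z => decide (s ∈ consistentStates F a θ z)
  have hC : Measurable C := measurable_pi_lambda _ fun z =>
    measurable_to_bool (by
      convert measurableSet_consistentStates F a θ z using 1
      ext s; simp [C])
  let g : ((Fin n → Bool) → Bool) → Fin n → Bool :=
    fun c => if h : ∃ z, c z = true then h.choose else fun _ => false
  refine ⟨g ∘ C, (measurable_of_countable g).comp hC, fun z s hs => ?_⟩
  have h : ∃ z, C s z = true := ⟨z, by simpa [C] using hs⟩
  have h' := h.choose_spec
  simp only [Function.comp_apply, g, dif_pos h]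
  simpa [C] using h'

/-- By Markov's inequality, most states are consistent with the input. -/
lemma le_measureReal_consistentStates (F : (Fin n → Bool) → Kernel Ω ℝ)
    [∀ q, IsMarkovKernel (F q)] (μ : Measure Ω) [IsProbabilityMeasure μ] {a δ θ : ℝ} (hθ : 0 < θ)
    (z : Fin n → Bool)
    (h : ∀ q, 1 - δ ≤ (F q ∘ₘ μ).real {r | |r - (n + hammingDist z q : ℝ)| ≤ a}) :
    1 - δ / θ ≤ μ.real (consistentStates F a θ z) := by
  have hint : ∀ q, Integrable
      (fun s => (F q s).real {r | a < |r - (n + hammingDist z q : ℝ)|}) μ := fun q =>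
    Integrable.of_bound
      ((F q).measurable_coe (measurableSet_lt_abs_sub _ _)).ennreal_toReal.aestronglyMeasurable
      1 (ae_of_all _ fun s => by
        rw [Real.norm_of_nonneg measureReal_nonneg]; exact measureReal_le_one)
  have hq : ∀ q, ∫ s, (F q s).real {r | a < |r - (n + hammingDist z q : ℝ)|} ∂μ ≤ δ := by
    intro q
    have hm := measurableSet_lt_abs_sub a (n + hammingDist z q : ℝ)
    have h1 : ∫ s, (F q s).real {r | a < |r - (n + hammingDist z q : ℝ)|} ∂μ =
        (F q ∘ₘ μ).real {r | a < |r - (n + hammingDist z q : ℝ)|} := by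
      rw [measureReal_def, Measure.bind_apply hm (F q).aemeasurable,
        ← integral_toReal ((F q).measurable_coe hm).aemeasurable
          (ae_of_all _ fun s => measure_lt_top _ _)]
      rfl
    have h2 := probReal_compl_eq_one_sub (μ := F q ∘ₘ μ) hm
    have h3 : {r : ℝ | a < |r - (n + hammingDist z q : ℝ)|}ᶜ =
        {r | |r - (n + hammingDist z q : ℝ)| ≤ a} := by ext r; simp
    rw [h3] at h2
    linarith [h q]
  have hE : ∫ s, errorMass F a z s ∂μ ≤ δ * 2 ^ n := by
    unfold errorMass
    rw [integral_finsetSum _ fun q _ => hint q]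
    refine (Finset.sum_le_sum fun q _ => hq q).trans (le_of_eq ?_)
    simp [mul_comm]
  have hI : Integrable (errorMass F a z) μ := integrable_finsetSum _ fun q _ => hint q
  have hM := mul_meas_ge_le_integral_of_nonneg (ae_of_all _ (errorMass_nonneg F a z)) hI
    (θ * 2 ^ n)
  have hc := probReal_compl_eq_one_sub (μ := μ) (measurableSet_consistentStates F a θ z)
  have hle : μ.real (consistentStates F a θ z)ᶜ ≤ μ.real {s | θ * 2 ^ n ≤ errorMass F a z s} := by
    refine measureReal_mono fun s hs => ?_
    simp only [consistentStates, Set.mem_compl_iff, Set.mem_ofPred_eq, not_le] at hs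
    exact hs.le
  have h2n : (0 : ℝ) < 2 ^ n := by positivity
  have : μ.real (consistentStates F a θ z)ᶜ ≤ δ / θ := by
    rw [le_div_iff₀ hθ]
    refine le_of_mul_le_mul_right ?_ h2n
    have := mul_le_mul_of_nonneg_left hle (by positivity : 0 ≤ θ * 2 ^ n)
    linarith
  linarith

/-- The sum over the bits `i` of the probabilities of events `A ∩ B i` is the integral over `A` of
the number of `i` with `B i`. -/
lemma sum_measureReal_inter_eq (μ : Measure Ω) [IsProbabilityMeasure μ] (A : Set Ω)
    {B : Fin n → Set Ω} (hB : ∀ i, MeasurableSet (B i)) :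
    ∑ i, μ.real (A ∩ B i) = ∫ s in A, ∑ i, (B i).indicator 1 s ∂μ := by
  rw [integral_finsetSum]
  · refine Finset.sum_congr rfl fun i _ => ?_
    rw [integral_indicator_one (hB i), measureReal_restrict_apply (hB i), Set.inter_comm]
  · intro i _
    exact (integrable_const (1 : ℝ)).indicator (hB i)

lemma integrable_sum_indicator_one (μ : Measure Ω) [IsFiniteMeasure μ]
    {B : Fin n → Set Ω} (hB : ∀ i, MeasurableSet (B i)) :
    Integrable (fun s => ∑ i, (B i).indicator (1 : Ω → ℝ) s) μ :=
  integrable_finsetSum _ fun i _ => (integrable_const (1 : ℝ)).indicator (hB i)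

lemma sum_measureReal_inter_le (μ : Measure Ω) [IsProbabilityMeasure μ] {A : Set Ω}
    (hA : MeasurableSet A) {B : Fin n → Set Ω} (hB : ∀ i, MeasurableSet (B i)) {c : ℝ}
    (hc : 0 ≤ c) (h : ∀ s ∈ A, ∑ i, (B i).indicator (1 : Ω → ℝ) s ≤ c) :
    ∑ i, μ.real (A ∩ B i) ≤ c := by
  rw [sum_measureReal_inter_eq μ A hB]
  refine (setIntegral_mono_on (integrable_sum_indicator_one _ hB) (integrable_const c) hA h).trans ?_
  rw [setIntegral_const, smul_eq_mul]
  exact mul_le_of_le_one_left hc measureReal_le_one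

lemma le_sum_measureReal_inter (μ : Measure Ω) [IsProbabilityMeasure μ] {A : Set Ω}
    (hA : MeasurableSet A) {B : Fin n → Set Ω} (hB : ∀ i, MeasurableSet (B i)) {c : ℝ}
    (h : ∀ s ∈ A, c ≤ ∑ i, (B i).indicator (1 : Ω → ℝ) s) :
    μ.real A * c ≤ ∑ i, μ.real (A ∩ B i) := by
  rw [sum_measureReal_inter_eq μ A hB, ← smul_eq_mul, ← setIntegral_const]
  exact setIntegral_mono_on (integrable_const c) (integrable_sum_indicator_one _ hB) hA h

/-- The reconstruction attack: a family of state laws which is stable, up to the factor `C`, under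
the flip of a bit, and from which all queries can be answered with error `a`, is impossible for
`a ^ 2` small compared with `n`. -/
theorem reconstruction_bound (μ : (Fin n → Bool) → Measure Ω) [∀ z, IsProbabilityMeasure (μ z)]
    (F : (Fin n → Bool) → Kernel Ω ℝ) [∀ q, IsMarkovKernel (F q)] {a δ θ C k : ℝ}
    (hθ : 0 < θ) (hθ' : θ < 1 / 6) (hC : 0 ≤ C) (ha : 0 ≤ a)
    (hk : k = 8 * (a + 1) ^ 2 / (1 - 6 * θ)) (hkn : k ≤ n)
    (hacc : ∀ z q, 1 - δ ≤ (F q ∘ₘ μ z).real {r | |r - (n + hammingDist z q : ℝ)| ≤ a})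
    (hpriv : ∀ z i I, MeasurableSet I → (μ z).real I ≤ C * (μ (flipBit z i)).real I) :
    (1 - δ / θ) * (n - k) ≤ C * k := by
  -- With tolerance `a + 1`, a state consistent with `z` at tolerance `a` remains consistent with
  -- every one-bit flip of `z`.
  obtain ⟨D, hD, hDc⟩ := exists_decoder F (a + 1) θ
  have h6 : 0 < 1 - 6 * θ := by linarith
  have hk0 : 0 ≤ k := by rw [hk]; positivity
  have hbit : ∀ (i : Fin n) (b : Bool), MeasurableSet {s | D s i = b} := fun i b =>
    (measurable_pi_apply i |>.comp hD) (measurableSet_singleton b)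
  have hbit' : ∀ (i : Fin n) (b : Bool), MeasurableSet {s | D s i ≠ b} := fun i b =>
    (hbit i b).compl
  have hdist : ∀ z s, s ∈ consistentStates F (a + 1) θ z → (hammingDist z (D s) : ℝ) ≤ k := by
    intro z s hs
    rw [hk, le_div_iff₀ h6]
    exact hammingDist_mul_le_of_errorMass_le F hs (hDc z s hs)
  have hsub : ∀ z, consistentStates F a θ z ⊆ consistentStates F (a + 1) θ z := by
    intro z s hs
    refine le_trans (Finset.sum_le_sum fun q _ => measureReal_mono fun r hr => ?_) hs
    simp only [Set.mem_ofPred_eq] at hr ⊢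
    linarith
  have hwrong : ∀ z s, ∑ i, ({s | D s i ≠ z i} : Set Ω).indicator (1 : Ω → ℝ) s =
      hammingDist z (D s) := by
    intro z s
    simp [hammingDist, Set.indicator_apply, Finset.sum_ite, ne_comm]
  have hright : ∀ z s, ∑ i, ({s | D s i = z i} : Set Ω).indicator (1 : Ω → ℝ) s =
      n - hammingDist z (D s) := by
    intro z s
    rw [← hwrong, eq_sub_iff_add_eq, ← Finset.sum_add_distrib]
    refine (Finset.sum_congr rfl fun i _ => ?_ : _ = ∑ i : Fin n, (1 : ℝ)).trans (by simp)
    by_cases h : D s i = z i <;> simp [h]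
  have hlow : ∀ z, (1 - δ / θ) * (n - k) ≤
      ∑ i, (μ z).real (consistentStates F a θ z ∩ {s | D s i = z i}) := by
    intro z
    refine le_trans (mul_le_mul_of_nonneg_right
      (le_measureReal_consistentStates F (μ z) hθ z (hacc z)) (by linarith))
      (le_sum_measureReal_inter _ (measurableSet_consistentStates F a θ z)
        (fun i => hbit i (z i)) fun s hs => ?_)
    rw [hright]
    linarith [hdist z s (hsub z hs)]
  -- Restricting to consistent states bounds the wrong bits pointwise, so no failure probability is
  -- added here.
  have hupp : ∀ z,
      ∑ i, (μ z).real (consistentStates F (a + 1) θ z ∩ {s | D s i ≠ z i}) ≤ k := by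
    intro z
    refine sum_measureReal_inter_le _ (measurableSet_consistentStates F (a + 1) θ z)
      (fun i => hbit' i (z i)) hk0 fun s hs => ?_
    rw [hwrong]
    exact hdist z s hs
  -- A decoded bit that is right for `z` is wrong for the flipped vector.
  have hflip : ∀ z i, (μ z).real (consistentStates F a θ z ∩ {s | D s i = z i}) ≤
      C * (μ (flipBit z i)).real
        (consistentStates F (a + 1) θ (flipBit z i) ∩ {s | D s i ≠ flipBit z i i}) := by
    intro z i
    refine (hpriv z i _ ((measurableSet_consistentStates F a θ z).inter (hbit i (z i)))).trans
      (mul_le_mul_of_nonneg_left (measureReal_mono fun s hs => ⟨?_, ?_⟩) hC)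
    · exact (errorMass_flipBit_le F a z i s).trans hs.1
    · have : D s i = z i := hs.2
      simp [this, flipBit_self]
  have hsum : ∑ _z : Fin n → Bool, (1 - δ / θ) * (n - k) ≤ ∑ _z : Fin n → Bool, C * k :=
    calc _ ≤ ∑ z, ∑ i, (μ z).real (consistentStates F a θ z ∩ {s | D s i = z i}) :=
          Finset.sum_le_sum fun z _ => hlow z
      _ ≤ ∑ z, ∑ i, C * (μ (flipBit z i)).real
            (consistentStates F (a + 1) θ (flipBit z i) ∩ {s | D s i ≠ flipBit z i i}) :=
          Finset.sum_le_sum fun z _ => Finset.sum_le_sum fun i _ => hflip z i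
      _ = ∑ z, ∑ i, C * (μ z).real (consistentStates F (a + 1) θ z ∩ {s | D s i ≠ z i}) := by
          -- For fixed `i`, flipping bit `i` permutes the vectors `z`.
          rw [Finset.sum_comm]
          refine Eq.trans ?_ Finset.sum_comm
          refine Finset.sum_congr rfl fun i _ => ?_
          have hinv : Function.Involutive fun z : Fin n → Bool => flipBit z i :=
            fun z => flipBit_flipBit z i
          exact Equiv.sum_comp hinv.toPerm fun z =>
            C * (μ z).real (consistentStates F (a + 1) θ z ∩ {s | D s i ≠ z i})
      _ ≤ _ := Finset.sum_le_sum fun z _ => by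
          rw [← Finset.mul_sum]
          exact mul_le_mul_of_nonneg_left (hupp z) hC
  rw [Finset.sum_const, Finset.sum_const, nsmul_eq_mul, nsmul_eq_mul] at hsum
  exact le_of_mul_le_mul_left hsum (by positivity)

end Reconstruction
end PanPrivacy
namespace PanPrivacy

/-! ### State laws of an online algorithm. -/

namespace OnlineAlgorithm

variable {U : Type*} (A : OnlineAlgorithm.{u} U)

/-- The transition kernel of the internal state for a sequence of updates. -/
noncomputable def steps : List (Update U) → Kernel A.State A.State
  | [] => Kernel.id
  | x :: Q => steps Q ∘ₖ A.step x

instance isMarkovKernel_steps (Q : List (Update U)) : IsMarkovKernel (A.steps Q) := by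
  induction Q with
  | nil => unfold steps; infer_instance
  | cons x Q ih => unfold steps; infer_instance

lemma foldl_bind_step (Q : List (Update U)) (μ : Measure A.State) :
    Q.foldl (fun μ x => μ.bind (A.step x)) μ = A.steps Q ∘ₘ μ := by
  induction Q generalizing μ with
  | nil => simp [steps]
  | cons x Q ih => rw [List.foldl_cons, ih, steps, ← Measure.comp_assoc]

lemma stateLaw_append (S Q : List (Update U)) :
    A.stateLaw (S ++ Q) = A.steps Q ∘ₘ A.stateLaw S := by
  rw [stateLaw, List.foldl_append, foldl_bind_step, stateLaw]

instance isProbabilityMeasure_stateLaw (S : List (Update U)) :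
    IsProbabilityMeasure (A.stateLaw S) := by
  rw [stateLaw, foldl_bind_step]
  infer_instance

instance isProbabilityMeasure_law (S : List (Update U)) : IsProbabilityMeasure (A.law S) := by
  rw [law]
  infer_instance

/-- Isolates the query phase as a kernel, so that all queries start from the same state law. -/
lemma law_append_real (S Q : List (Update U)) {B : Set ℝ} (hB : MeasurableSet B) :
    (A.law (S ++ Q)).real {p | p.2 ∈ B} = ((A.output ∘ₖ A.steps Q) ∘ₘ A.stateLaw S).real B := by
  rw [← Measure.comp_assoc, ← stateLaw_append, ← Measure.snd_compProd, measureReal_def,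
    measureReal_def, Measure.snd_apply hB]
  rfl

lemma stateLaw_real_le [DecidableEq U] {M : StreamModel} {ε : ℝ} (h : A.PanPrivate M ε)
    {S S' : List (Update U)} (hS : M.Admissible S) (hS' : M.Admissible S') (hN : Neighbors S S')
    {I : Set A.State} (hI : MeasurableSet I) :
    (A.stateLaw S).real I ≤ Real.exp ε * (A.stateLaw S').real I := by
  have key : ∀ T : List (Update U), A.law T (I ×ˢ Set.univ) = A.stateLaw T I := fun T => by
    rw [law, Measure.compProd_apply_prod hI MeasurableSet.univ]
    simp
  have := h S S' hS hS' hN I Set.univ hI MeasurableSet.univ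
  rw [key, key] at this
  have h2 := ENNReal.toReal_mono (ENNReal.mul_ne_top ENNReal.ofReal_ne_top (measure_ne_top _ _))
    this
  rwa [ENNReal.toReal_mul, ENNReal.toReal_ofReal (Real.exp_pos ε).le] at h2

end OnlineAlgorithm

/-! ### Encoding bit vectors as streams. -/

section Encoding

variable {U : Type*} {n : ℕ}

/-- The input that inserts, for each position `i`, one of two IDs according to the bit `z i`. -/
def encode (e : Fin n × Bool ↪ U) (z : Fin n → Bool) : List (Update U) :=
  List.ofFn fun i => (e (i, z i), 1)

lemma admissible_of_forall_eq_one (M : StreamModel) {S : List (Update U)}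
    (h : ∀ x ∈ S, x.2 = 1) : M.Admissible S := by
  cases M
  · intro x hx
    simp [h x hx]
  · trivial

lemma forall_mem_encode (e : Fin n × Bool ↪ U) (z : Fin n → Bool) :
    ∀ x ∈ encode e z, x.2 = 1 := by
  intro x hx
  obtain ⟨i, rfl⟩ := (List.mem_ofFn' _ _).1 hx
  rfl

variable [DecidableEq U]

lemma stateVector_eq_sum_map (S : List (Update U)) (l : U) :
    stateVector S l = (S.map fun x => if x.1 = l then x.2 else 0).sum := by
  rw [stateVector, Finset.sum_filter]
  conv_rhs => rw [← List.ofFn_get S, List.map_ofFn, List.sum_ofFn]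
  rfl

lemma stateVector_append (S T : List (Update U)) (l : U) :
    stateVector (S ++ T) l = stateVector S l + stateVector T l := by
  simp [stateVector_eq_sum_map]

lemma stateVector_encode (e : Fin n × Bool ↪ U) (z : Fin n → Bool) (i : Fin n) (b : Bool) :
    stateVector (encode e z) (e (i, b)) = if z i = b then 1 else 0 := by
  rw [stateVector_eq_sum_map, encode, List.map_ofFn, List.sum_ofFn, Finset.sum_eq_single i]
  · simp
  · intro j _ hj; simp [hj]
  · simp

lemma stateVector_encode_of_notMem (e : Fin n × Bool ↪ U) (z : Fin n → Bool) {l : U}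
    (hl : l ∉ Set.range e) : stateVector (encode e z) l = 0 := by
  rw [stateVector_eq_sum_map, encode, List.map_ofFn, List.sum_ofFn]
  refine Finset.sum_eq_zero fun i _ => ?_
  have : e (i, z i) ≠ l := fun h => hl ⟨_, h⟩
  simp [this]

/-- A position contributes one ID where the bits agree and two where they differ; positive updates
cannot cancel. -/
lemma distinctCount_encode_append [Fintype U] (e : Fin n × Bool ↪ U) (z q : Fin n → Bool) :
    distinctCount (encode e z ++ encode e q) = n + hammingDist z q := by
  have h : ({l : U | stateVector (encode e z ++ encode e q) l ≠ 0} : Finset U) =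
      (({p : Fin n × Bool | z p.1 = p.2 ∨ q p.1 = p.2} : Finset (Fin n × Bool)).map e) := by
    ext l
    simp only [Finset.mem_filter, Finset.mem_univ, true_and, Finset.mem_map, stateVector_append]
    by_cases hl : l ∈ Set.range e
    · obtain ⟨⟨i, b⟩, rfl⟩ := hl
      rw [stateVector_encode, stateVector_encode]
      simp only [EmbeddingLike.apply_eq_iff_eq, exists_eq_right]
      by_cases h1 : z i = b <;> by_cases h2 : q i = b <;> simp [h1, h2]
    · rw [stateVector_encode_of_notMem e z hl, stateVector_encode_of_notMem e q hl]
      simp only [add_zero, ne_eq, not_true_eq_false, false_iff]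
      rintro ⟨p, _, rfl⟩
      exact hl ⟨p, rfl⟩
  rw [distinctCount, h, Finset.card_map, Finset.card_filter, Fintype.sum_prod_type,
    hammingDist, Finset.card_filter]
  refine Eq.trans ?_ (congrArg (· + _) (show ∑ _i : Fin n, 1 = n by simp))
  rw [← Finset.sum_add_distrib]
  refine Finset.sum_congr rfl fun i _ => ?_
  rw [Fintype.sum_bool]
  cases z i <;> cases q i <;> rfl

lemma neighbors_encode_flipBit (e : Fin n × Bool ↪ U) (z : Fin n → Bool) (i : Fin n) :
    Neighbors (encode e z) (encode e (flipBit z i)) := by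
  have hlen : ∀ y : Fin n → Bool, n = (encode e y).length := fun y => by simp [encode]
  have hget : ∀ (y : Fin n → Bool) (k : Fin n),
      (encode e y).get (Fin.cast (hlen y) k) = (e (k, y k), 1) := fun y k => by
    simp only [encode, List.get_ofFn]
    rfl
  refine ⟨e (i, z i), e (i, !z i), by simp, {Fin.cast (hlen _) i}, {Fin.cast (hlen _) i},
    ?_, ?_, ?_, ?_⟩
  · intro k hk
    rw [Finset.mem_singleton.1 hk, hget]
  · intro k hk
    rw [Finset.mem_singleton.1 hk, hget, flipBit_self]
  · rw [Finset.sum_singleton, Finset.sum_singleton, hget, hget]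
  · intro l
    have key : ∀ y : Fin n → Bool,
        ∑ k ∈ ({Fin.cast (hlen y) i} : Finset (Fin (encode e y).length))ᶜ with
          ((encode e y).get k).1 = l, ((encode e y).get k).2 =
        ∑ k : Fin n, if k = i then 0 else if e (k, y k) = l then 1 else 0 := by
      intro y
      rw [Finset.sum_filter, ← Finset.univ_inter ({Fin.cast (hlen y) i}ᶜ : Finset _),
        ← Finset.sum_ite_mem, ← (finCongr (hlen y)).sum_comp]
      refine Finset.sum_congr rfl fun k _ => ?_
      rw [finCongr_apply, hget]
      simp [ite_not]
    rw [key, key]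
    refine Finset.sum_congr rfl fun k _ => ?_
    by_cases hk : k = i
    · simp [hk]
    · simp [hk, flipBit]

end Encoding

/-! ### The lower bound and its asymptotics. -/

/-- An accurate and private algorithm over a universe with at least `2 * n` IDs has an error at
least of the order of `√n`. -/
theorem OnlineAlgorithm.bound_of_panPrivate {m n : ℕ} (hmn : 2 * n ≤ m) {M : StreamModel}
    (A : OnlineAlgorithm.{u} (Fin m)) {a δ θ ε k : ℝ} (hθ : 0 < θ) (hθ' : θ < 1 / 6) (ha : 0 ≤ a)
    (hk : k = 8 * (a + 1) ^ 2 / (1 - 6 * θ)) (hkn : k ≤ n)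
    (hA : A.EstimatesDistinctCount M a δ) (hP : A.PanPrivate M ε) :
    (1 - δ / θ) * (n - k) ≤ Real.exp ε * k := by
  obtain ⟨e⟩ : Nonempty (Fin n × Bool ↪ Fin m) :=
    Function.Embedding.nonempty_of_card_le (by simp; omega)
  refine reconstruction_bound (fun z => A.stateLaw (encode e z))
    (fun q => A.output ∘ₖ A.steps (encode e q)) hθ hθ' (Real.exp_pos ε).le ha hk hkn ?_ ?_
  · intro z q
    have h := hA (encode e z ++ encode e q) (admissible_of_forall_eq_one M fun x hx => by
      rcases List.mem_append.1 hx with hx | hx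
      exacts [forall_mem_encode e z x hx, forall_mem_encode e q x hx])
    rw [distinctCount_encode_append, Nat.cast_add] at h
    rwa [← A.law_append_real _ _ (measurableSet_le (by fun_prop) measurable_const)]
  · intro z i I hI
    exact A.stateLaw_real_le hP (admissible_of_forall_eq_one M (forall_mem_encode e z))
      (admissible_of_forall_eq_one M (forall_mem_encode e _)) (neighbors_encode_flipBit e z i) hI

lemma rhoStar_le_one : rhoStar ≤ 1 := measureReal_le_one

end PanPrivacy

theorem mainTheorem8 (M : PanPrivacy.StreamModel) (δ η : ℝ) (hη : 0 ≤ η)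
    (hδ : δ < PanPrivacy.rhoStar / (6 * (1 + η)))
    (α : ℕ → ℝ) (hα : α =o[atTop] fun m : ℕ => √(m : ℝ)) (ε : ℝ) :
    ∀ᶠ m : ℕ in atTop, ∀ A : PanPrivacy.OnlineAlgorithm.{u} (Fin m),
      A.EstimatesDistinctCount M (α m) δ → ¬ A.PanPrivate M ε := by
  have hδ6 : δ < 1 / 6 := hδ.trans_le
    (div_le_div₀ zero_le_one PanPrivacy.rhoStar_le_one (by norm_num) (by linarith))
  -- Strictly between `δ` and `1 / 6`; the maximum keeps `θ` positive when `δ` is negative.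
  set θ : ℝ := (max δ 0 + 1 / 6) / 2 with hθdef
  have hmax : max δ 0 < 1 / 6 := max_lt hδ6 (by norm_num)
  have hθ : 0 < θ := by have := le_max_right δ 0; linarith
  have hθ' : θ < 1 / 6 := by linarith
  have hδθ : δ < θ := by have := le_max_left δ 0; linarith
  have hp : 0 < 1 - δ / θ := by rw [sub_pos, div_lt_one hθ]; exact hδθ
  have hκ : 0 < 1 - 6 * θ := by linarith
  set p := 1 - δ / θ
  set κ := 1 - 6 * θ
  set C := Real.exp ε
  have hC : 0 < C := Real.exp_pos ε
  -- Chosen to give `k * (C + p) ≤ p * m / 8`, whereas the attack with `n = m / 2 ≥ m / 4` forces `p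
  -- * n ≤ k * (C + p)`.
  have hc : 0 < √(p * κ / (256 * (C + p))) := Real.sqrt_pos.2 (by positivity)
  have hone : (fun _ : ℕ => (1 : ℝ)) =o[atTop] fun m : ℕ => √(m : ℝ) :=
    isLittleO_const_left.2 (.inr (tendsto_norm_atTop_atTop.comp
      (Real.tendsto_sqrt_atTop.comp tendsto_natCast_atTop_atTop)))
  filter_upwards [hα.bound hc, hone.bound hc, eventually_ge_atTop 2] with m h1 h2 hm A hA hP
  rw [Real.norm_of_nonneg (Real.sqrt_nonneg _), Real.norm_eq_abs] at h1
  rw [Real.norm_of_nonneg (Real.sqrt_nonneg _), Real.norm_eq_abs, abs_one] at h2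
  set k := 8 * (|α m| + 1) ^ 2 / κ with hk
  have hsq : (|α m| + 1) ^ 2 ≤ p * κ / (64 * (C + p)) * m := by
    have h := pow_le_pow_left₀ (by positivity) (add_le_add h1 h2) 2
    have hs := Real.sq_sqrt (show 0 ≤ p * κ / (256 * (C + p)) by positivity)
    have hs' := Real.sq_sqrt (Nat.cast_nonneg (α := ℝ) m)
    calc _ ≤ _ := h
      _ = 4 * (√(p * κ / (256 * (C + p))) ^ 2 * √(m : ℝ) ^ 2) := by ring
      _ = _ := by rw [hs, hs']; field_simp; norm_num
  have hkm : k * (C + p) ≤ p * (m / 8) := by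
    calc _ ≤ 8 * (p * κ / (64 * (C + p)) * m) / κ * (C + p) := by rw [hk]; gcongr
      _ = _ := by field_simp; norm_num
  have hm0 : (0 : ℝ) < m := by exact_mod_cast (by omega : 0 < m)
  have hn : (m : ℝ) / 4 ≤ ((m / 2 : ℕ) : ℝ) := by
    have : (m : ℝ) ≤ 4 * ((m / 2 : ℕ) : ℝ) := by exact_mod_cast (by omega : m ≤ 4 * (m / 2))
    linarith
  have hk0 : 0 ≤ k := by positivity
  have hkn : k ≤ ((m / 2 : ℕ) : ℝ) := by
    have : p * k ≤ p * (m / 8) := by nlinarith [mul_nonneg hk0 hC.le]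
    have := le_of_mul_le_mul_left this hp
    linarith
  have hA' : A.EstimatesDistinctCount M |α m| δ := fun S hS =>
    (hA S hS).trans (measureReal_mono fun x (hx : |_| ≤ α m) => hx.trans (le_abs_self _))
  have := A.bound_of_panPrivate (n := m / 2) (by omega) hθ hθ' (abs_nonneg _) hk hkn hA' hP
  have := mul_le_mul_of_nonneg_left hn hp.le
  nlinarith [mul_pos hp hm0]
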